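/- Let $d\ge 1$, $\varepsilon>0$, and let $\varrho_0$ be a Borel probability measure on $\mathbb{R}^d$ that has compact support and is absolutely continuous with respect to Lebesgue measure. Let $\mathcal P_2(\mathbb{R}^d)$ be the space of Borel probability measures on $\mathbb{R}^d$ with finite second moment, with the topology of the quadratic Wasserstein distance $\mathcal W_2(\mu,\nu)=\big(\inf_\Pi\int|x-y|^2\,d\Pi(x,y)\big)^{1/2}$, the infimum being over all probability measures $\Pi$ on $\mathbb{R}^d\times\mathbb{R}^d$ with marginals $\mu$ and $\nu$. Let $\mathcal P_c^{ac}(\mathbb{R}^d)$ be the set of compactly supported, absolutely continuous probability measures, and let $\overline{\mathbf B}_\varepsilon(\varrho_0)=\{\mu\in\mathcal P_2(\mathbb{R}^d):\mathcal W_2(\mu,\varrho_0)\le\varepsilon\}$. Let $\Gamma_\varepsilon(\varrho_0)$ be the set of all pushforwards $(\Phi_{0,t})_\sharp\varrho_0$, $t\in[0,\varepsilon]$, where $\Phi$ is the flow of a vector field $v:[0,\varepsilon]\times\mathbb{R}^d\to\mathbb{R}^d$ such that $t\mapsto v_t(x)$ is measurable for every $x$ and $\operatorname{ess\,sup}_{t\in[0,\varepsilon]}\max\{\sup_x|v_t(x)|,\operatorname{Lip}(v_t)\}\le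 1$; that is, $\Phi_{0,t}(x)=x+\int_0^t v_\tau(\Phi_{0,\tau}(x))\,d\tau$ for all $x\in\mathbb{R}^d$, $t\in[0,\varepsilon]$. Then $\Gamma_\varepsilon(\varrho_0)$ is contained in $\mathcal P_c^{ac}(\mathbb{R}^d)\cap\overline{\mathbf B}_\varepsilon(\varrho_0)$, it is compact in $\mathcal P_2(\mathbb{R}^d)$, and it is nowhere dense in $\mathcal P_c^{ac}(\mathbb{R}^d)\cap\overline{\mathbf B}_\varepsilon(\varrho_0)$ with the subspace topology. -/

import Mathlib

open MeasureTheory Set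
open scoped ENNReal

namespace WassersteinFlow

/-- The Euclidean space `ℝ^d`. -/
abbrev E (d : ℕ) : Type := EuclideanSpace ℝ (Fin d)

/-- The quadratic Wasserstein space `𝒫₂(ℝ^d)`: Borel probability measures on `ℝ^d` with finite
second moment. -/
@[ext]
structure P2 (d : ℕ) : Type where
  /-- The underlying Borel measure. -/
  toMeasure : Measure (E d)
  isProb : IsProbabilityMeasure toMeasure
  finiteSecondMoment : ∫⁻ x, ‖x‖ₑ ^ 2 ∂toMeasure < ∞

/-- The transport plans between `μ` and `ν`: probability measures on `ℝ^d × ℝ^d` with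
marginals `μ` and `ν`. -/
def transportPlans {d : ℕ} (μ ν : Measure (E d)) : Set (Measure (E d × E d)) :=
  {π | IsProbabilityMeasure π ∧ π.map Prod.fst = μ ∧ π.map Prod.snd = ν}

/-- The 2-Wasserstein distance on `𝒫₂(ℝ^d)`, as an extended nonnegative number. -/
noncomputable def W2 {d : ℕ} (μ ν : P2 d) : ℝ≥0∞ :=
  (⨅ π ∈ transportPlans μ.toMeasure ν.toMeasure, ∫⁻ p, ‖p.1 - p.2‖ₑ ^ 2 ∂π) ^ (1 / 2 : ℝ)

/-- The Wasserstein topology on `𝒫₂(ℝ^d)`: a set is open iff together with each of its points it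
contains a Wasserstein ball of positive radius around this point. -/
instance instTopologicalSpaceP2 (d : ℕ) : TopologicalSpace (P2 d) where
  IsOpen U := ∀ μ ∈ U, ∃ r : ℝ, 0 < r ∧ ∀ ν : P2 d, W2 μ ν < ENNReal.ofReal r → ν ∈ U
  isOpen_univ := fun _ _ => ⟨1, one_pos, fun _ _ => mem_univ _⟩
  isOpen_inter := by
    rintro U V hU hV μ ⟨hμU, hμV⟩
    obtain ⟨r, hr, hrU⟩ := hU μ hμU
    obtain ⟨s, hs, hsV⟩ := hV μ hμV
    refine ⟨min r s, lt_min hr hs, fun ν hν => ⟨hrU ν (hν.trans_le ?_), hsV ν (hν.trans_le ?_)⟩⟩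
    · exact ENNReal.ofReal_le_ofReal (min_le_left r s)
    · exact ENNReal.ofReal_le_ofReal (min_le_right r s)
  isOpen_sUnion := by
    rintro S hS μ ⟨U, hUS, hμU⟩
    obtain ⟨r, hr, hrU⟩ := hS U hUS μ hμU
    exact ⟨r, hr, fun ν hν => ⟨U, hUS, hrU ν hν⟩⟩

/-- The closed Wasserstein ball of radius `r` around `μ`. -/
def closedBallW2 {d : ℕ} (μ : P2 d) (r : ℝ) : Set (P2 d) :=
  {ν | W2 ν μ ≤ ENNReal.ofReal r}

/-- `𝒫_c^{ac}(ℝ^d)`: the measures in `𝒫₂(ℝ^d)` that have compact support and are absolutely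
continuous with respect to Lebesgue measure. -/
def PcAC (d : ℕ) : Set (P2 d) :=
  {μ | IsCompact μ.toMeasure.support ∧ μ.toMeasure ≪ volume}

/-- The Lipschitz norm `max {‖f‖_∞, Lip f}`, with value `∞` if `f` is unbounded or not Lipschitz.
In the second supremum the terms with `x = y` are `0 / 0 = 0`. -/
noncomputable def lipNorm {d : ℕ} (f : E d → E d) : ℝ≥0∞ :=
  max (⨆ x, ‖f x‖ₑ) (⨆ x, ⨆ y, ‖f x - f y‖ₑ / ‖x - y‖ₑ)

/-- Nonautonomous vector fields `v ∈ L^∞([0,T]; Lip(ℝ^d;ℝ^d))` with `‖v‖_∞ ≤ 1`: the map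
`t ↦ v t x` is Lebesgue measurable on `[0,T]` for every `x`, and the essential supremum over
`t ∈ [0,T]` of the Lipschitz norm of `v t` is at most `1`. -/
def IsUnitLipField {d : ℕ} (T : ℝ) (v : ℝ → E d → E d) : Prop :=
  (∀ x, AEStronglyMeasurable (fun t => v t x) (volume.restrict (Icc 0 T))) ∧
    essSup (fun t => lipNorm (v t)) (volume.restrict (Icc 0 T)) ≤ 1

/-- `Φ t = Φ_{0,t}`, `t ∈ [0,T]`, is the flow of `v` started at time `0`: for every `x` the curve
`t ↦ Φ t x` is the Carathéodory solution on `[0,T]` of `y' = v t y`, `y 0 = x`. -/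
def IsFlow {d : ℕ} (T : ℝ) (v : ℝ → E d → E d) (Φ : ℝ → E d → E d) : Prop :=
  ∀ x, IntervalIntegrable (fun τ => v τ (Φ τ x)) volume 0 T ∧
    ∀ t ∈ Icc 0 T, Φ t x = x + ∫ τ in (0 : ℝ)..t, v τ (Φ τ x)

/-- `Γ_ε(ρ₀)`: all pushforwards `Φ_{0,t♯} ρ₀`, `t ∈ [0,ε]`, where `Φ` is the flow of a vector field
`v ∈ L^∞([0,ε]; Lip(ℝ^d;ℝ^d))` with `‖v‖_∞ ≤ 1`. -/
def Gamma {d : ℕ} (ε : ℝ) (ρ₀ : P2 d) : Set (Measure (E d)) :=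
  {μ | ∃ v Φ : ℝ → E d → E d, IsUnitLipField ε v ∧ IsFlow ε v Φ ∧
    ∃ t ∈ Icc 0 ε, μ = ρ₀.toMeasure.map (Φ t)}

end WassersteinFlow

namespace WassersteinFlow

variable {d : ℕ}

/-! The vector fields are eliminated. Up to restriction to `[0, ε]`, their flows are exactly the
elements of `unitFlows`, a class cut out by pointwise inequalities alone. Grönwall gives one
direction (`exists_mem_unitFlows_of_isFlow`). Conversely, every `Φ t` is bijective, and `∂ₜΦ ∘ Φ⁻¹`,
which makes sense for almost every `t`, is a field driving `Φ`
(`exists_isUnitLipField_of_mem_unitFlows`).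

The class is closed under pointwise limits and lies in a product of compact balls, hence is compact.
The pushforward is continuous in `(Φ, t)`, so the reachable set is a continuous image of a compact
set. Points move by at most `t`, which bounds the distance to the initial measure, and `Φ t` is
antilipschitz, which preserves absolute continuity.

The Wasserstein topology is Hausdorff, so the reachable set is closed and only its interior matters.
Its elements live in one fixed ball, so sending a tiny mass outside that ball leaves the set.
Stopping the flow slightly earlier first pays for this transport within the closed Wasserstein ball
(`exists_near_notMem_Gamma`). -/

instance (μ : P2 d) : IsProbabilityMeasure μ.toMeasure := μ.isProb

/-! ### Transport plans and the Wasserstein distance -/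

lemma W2_le_of_mem_transportPlans {μ ν : P2 d} {π : Measure (E d × E d)}
    (hπ : π ∈ transportPlans μ.toMeasure ν.toMeasure) {c : ℝ≥0∞}
    (h : ∫⁻ p, ‖p.1 - p.2‖ₑ ^ 2 ∂π ≤ c ^ 2) : W2 μ ν ≤ c := by
  unfold W2
  calc _ ≤ (c ^ 2) ^ (1 / 2 : ℝ) :=
        ENNReal.rpow_le_rpow ((iInf₂_le π hπ).trans h) (by norm_num)
    _ = c := by
        rw [← ENNReal.rpow_natCast, ← ENNReal.rpow_mul]
        norm_num

lemma exists_transportPlan_of_W2_lt {μ ν : P2 d} {c : ℝ≥0∞} (h : W2 μ ν < c) :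
    ∃ π ∈ transportPlans μ.toMeasure ν.toMeasure, ∫⁻ p, ‖p.1 - p.2‖ₑ ^ 2 ∂π < c ^ 2 := by
  have hc : c = (c ^ 2) ^ (1 / 2 : ℝ) := by
    rw [← ENNReal.rpow_natCast, ← ENNReal.rpow_mul]
    norm_num
  rw [hc, W2, ENNReal.rpow_lt_rpow_iff (by norm_num)] at h
  simpa only [iInf_lt_iff, exists_prop] using h

lemma map_prodMk_mem_transportPlans (ρ : Measure (E d)) [IsProbabilityMeasure ρ]
    {f g : E d → E d} (hf : Measurable f) (hg : Measurable g) :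
    ρ.map (fun x => (f x, g x)) ∈ transportPlans (ρ.map f) (ρ.map g) := by
  refine ⟨Measure.isProbabilityMeasure_map (hf.prodMk hg).aemeasurable, ?_, ?_⟩
  · rw [Measure.map_map measurable_fst (hf.prodMk hg)]; rfl
  · rw [Measure.map_map measurable_snd (hf.prodMk hg)]; rfl

lemma prod_mem_transportPlans (μ ν : Measure (E d)) [IsProbabilityMeasure μ]
    [IsProbabilityMeasure ν] : μ.prod ν ∈ transportPlans μ ν := by
  refine ⟨inferInstance, ?_, ?_⟩
  · simp
  · simp

lemma isProbabilityMeasure_mix {α : Type*} [MeasurableSpace α] {μ ν : Measure α}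
    [IsProbabilityMeasure μ] [IsProbabilityMeasure ν] {a b : ℝ≥0∞} (hab : a + b = 1) :
    IsProbabilityMeasure (a • μ + b • ν) :=
  ⟨by simp [hab]⟩

lemma mix_mem_transportPlans {μ₁ ν₁ μ₂ ν₂ : Measure (E d)} {π₁ π₂ : Measure (E d × E d)}
    (h₁ : π₁ ∈ transportPlans μ₁ ν₁) (h₂ : π₂ ∈ transportPlans μ₂ ν₂) {a b : ℝ≥0∞}
    (hab : a + b = 1) :
    a • π₁ + b • π₂ ∈ transportPlans (a • μ₁ + b • μ₂) (a • ν₁ + b • ν₂) := by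
  obtain ⟨p₁, f₁, s₁⟩ := h₁
  obtain ⟨p₂, f₂, s₂⟩ := h₂
  refine ⟨isProbabilityMeasure_mix hab, ?_, ?_⟩
  · rw [Measure.map_add _ _ measurable_fst, Measure.map_smul, Measure.map_smul, f₁, f₂]
  · rw [Measure.map_add _ _ measurable_snd, Measure.map_smul, Measure.map_smul, s₁, s₂]

lemma lintegral_sq_map_prodMk_le (ρ : Measure (E d)) [IsProbabilityMeasure ρ]
    {f g : E d → E d} (hf : Measurable f) (hg : Measurable g) {c : ℝ}
    (h : ∀ᵐ x ∂ρ, ‖f x - g x‖ ≤ c) :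
    ∫⁻ p, ‖p.1 - p.2‖ₑ ^ 2 ∂(ρ.map fun x => (f x, g x)) ≤ ENNReal.ofReal c ^ 2 := by
  rw [lintegral_map (by fun_prop) (hf.prodMk hg)]
  calc _ ≤ ∫⁻ _, ENNReal.ofReal c ^ 2 ∂ρ := by
        refine lintegral_mono_ae ?_
        filter_upwards [h] with x hx
        gcongr
        rw [← ofReal_norm]
        exact ENNReal.ofReal_le_ofReal hx
    _ = _ := by simp

lemma lintegral_sq_transportPlan_le {μ ν : Measure (E d)} {π : Measure (E d × E d)}
    (hπ : π ∈ transportPlans μ ν) {R : ℝ} (hμ : μ (Metric.closedBall 0 R)ᶜ = 0)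
    (hν : ν (Metric.closedBall 0 R)ᶜ = 0) :
    ∫⁻ p, ‖p.1 - p.2‖ₑ ^ 2 ∂π ≤ ENNReal.ofReal (2 * R) ^ 2 := by
  obtain ⟨hp, rfl, rfl⟩ := hπ
  have h1 : ∀ᵐ p ∂π, p.1 ∈ Metric.closedBall (0 : E d) R :=
    ae_of_ae_map measurable_fst.aemeasurable (mem_ae_iff.2 hμ)
  have h2 : ∀ᵐ p ∂π, p.2 ∈ Metric.closedBall (0 : E d) R :=
    ae_of_ae_map measurable_snd.aemeasurable (mem_ae_iff.2 hν)
  calc _ ≤ ∫⁻ _, ENNReal.ofReal (2 * R) ^ 2 ∂π := by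
        refine lintegral_mono_ae ?_
        filter_upwards [h1, h2] with p hp1 hp2
        gcongr
        rw [← ofReal_norm]
        rw [mem_closedBall_zero_iff] at hp1 hp2
        exact ENNReal.ofReal_le_ofReal ((norm_sub_le _ _).trans (by linarith))
    _ = _ := by simp

/-! ### The Wasserstein topology is Hausdorff -/

/-- The easy half of Kantorovich duality: a plan of quadratic cost below `c ^ 2` has first-order
cost at most `c`, by Jensen. -/
lemma enorm_integral_sub_integral_le {f : E d → ℂ} {K : NNReal} (hf : LipschitzWith K f)
    {C : ℝ} (hC : ∀ x, ‖f x‖ ≤ C) {μ ν : P2 d} {c : ℝ≥0∞} (h : W2 μ ν < c) :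
    ‖∫ x, f x ∂μ.toMeasure - ∫ x, f x ∂ν.toMeasure‖ₑ ≤ K * c := by
  obtain ⟨π, ⟨hp, h1, h2⟩, hπ⟩ := exists_transportPlan_of_W2_lt h
  have hfm : StronglyMeasurable f := hf.continuous.stronglyMeasurable
  have i1 : Integrable (fun p : E d × E d => f p.1) π :=
    Integrable.of_bound (hfm.comp_measurable measurable_fst).aestronglyMeasurable C
      (ae_of_all _ fun p => hC _)
  have i2 : Integrable (fun p : E d × E d => f p.2) π :=
    Integrable.of_bound (hfm.comp_measurable measurable_snd).aestronglyMeasurable C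
      (ae_of_all _ fun p => hC _)
  have hl : ∫⁻ p, ‖p.1 - p.2‖ₑ ∂π ≤ c := by
    have hm : AEStronglyMeasurable (fun p : E d × E d => p.1 - p.2) π := by fun_prop
    have := eLpNorm_le_eLpNorm_of_exponent_le (p := 1) (q := 2) (by norm_num) hm
    rw [eLpNorm_one_eq_lintegral_enorm] at this
    refine this.trans ?_
    rw [eLpNorm_eq_lintegral_rpow_enorm_toReal (by norm_num) (by norm_num)]
    calc _ ≤ (c ^ 2) ^ (1 / 2 : ℝ) := by
          simp only [ENNReal.toReal_ofNat, ENNReal.rpow_ofNat]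
          exact ENNReal.rpow_le_rpow hπ.le (by norm_num)
      _ = c := by
          rw [← ENNReal.rpow_natCast, ← ENNReal.rpow_mul]
          norm_num
  rw [← h1, ← h2, integral_map measurable_fst.aemeasurable hfm.aestronglyMeasurable,
    integral_map measurable_snd.aemeasurable hfm.aestronglyMeasurable, ← integral_sub i1 i2]
  calc _ ≤ ∫⁻ p, ‖f p.1 - f p.2‖ₑ ∂π := enorm_integral_le_lintegral_enorm _
    _ ≤ ∫⁻ p, K * ‖p.1 - p.2‖ₑ ∂π := by
        refine lintegral_mono fun p => ?_
        simpa only [edist_eq_enorm_sub] using hf p.1 p.2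
    _ = K * ∫⁻ p, ‖p.1 - p.2‖ₑ ∂π := lintegral_const_mul _ (by fun_prop)
    _ ≤ K * c := by gcongr

lemma isOpen_P2_iff {U : Set (P2 d)} :
    IsOpen U ↔ ∀ μ ∈ U, ∃ r : ℝ, 0 < r ∧ ∀ ν : P2 d, W2 μ ν < ENNReal.ofReal r → ν ∈ U :=
  Iff.rfl

lemma continuous_integral_of_lipschitz {f : E d → ℂ} {K : NNReal} (hf : LipschitzWith K f)
    {C : ℝ} (hC : ∀ x, ‖f x‖ ≤ C) : Continuous fun μ : P2 d => ∫ x, f x ∂μ.toMeasure := by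
  refine continuous_def.2 fun U hU => isOpen_P2_iff.2 fun μ hμ => ?_
  obtain ⟨r, hr, hrU⟩ := Metric.isOpen_iff.1 hU _ hμ
  refine ⟨r / (K + 1), by positivity, fun ν hν => hrU ?_⟩
  have := enorm_integral_sub_integral_le hf hC hν
  rw [Metric.mem_ball, dist_comm, dist_eq_norm]
  rw [← ofReal_norm, ← ENNReal.ofReal_coe_nnreal,
    ← ENNReal.ofReal_mul (by positivity), ENNReal.ofReal_le_ofReal_iff (by positivity)] at this
  refine this.trans_lt ?_
  rw [mul_div_assoc', div_lt_iff₀ (by positivity)]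
  nlinarith [K.coe_nonneg]

lemma continuous_charFun (t : E d) : Continuous fun μ : P2 d => charFun μ.toMeasure t := by
  simp only [charFun_apply]
  refine continuous_integral_of_lipschitz (K := ‖t‖₊) (C := 1) ?_ fun x => ?_
  · refine LipschitzWith.of_dist_le_mul fun x y => ?_
    have key : Complex.exp (inner ℝ x t * Complex.I) - Complex.exp (inner ℝ y t * Complex.I)
        = Complex.exp (inner ℝ y t * Complex.I) *
          (Complex.exp (Complex.I * (inner ℝ (x - y) t : ℝ)) - 1) := by
      rw [mul_sub, ← Complex.exp_add, inner_sub_left]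
      push_cast
      ring_nf
    rw [dist_eq_norm, key, norm_mul, Complex.norm_exp_ofReal_mul_I, one_mul]
    refine (Real.norm_exp_I_mul_ofReal_sub_one_le).trans ?_
    rw [dist_eq_norm, coe_nnnorm, mul_comm]
    exact norm_inner_le_norm _ _
  · rw [Complex.norm_exp_ofReal_mul_I]

/-- Characteristic functions are continuous and separate measures; no triangle inequality for `W2`
is needed. -/
instance : T2Space (P2 d) := by
  refine ⟨fun μ ν hne => ?_⟩
  have : ∃ t, charFun μ.toMeasure t ≠ charFun ν.toMeasure t := by
    by_contra! h
    exact hne (P2.ext (Measure.ext_of_charFun (funext h)))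
  obtain ⟨t, ht⟩ := this
  exact separated_by_continuous (continuous_charFun t) ht

/-! ### Measures carried by a ball -/

lemma isCompact_support_of_closedBall {μ : Measure (E d)} {R : ℝ}
    (h : μ (Metric.closedBall 0 R)ᶜ = 0) : IsCompact μ.support :=
  (isCompact_closedBall (0 : E d) R).of_isClosed_subset Measure.isClosed_support
    (Measure.support_subset_of_isClosed Metric.isClosed_closedBall (mem_ae_iff.2 h))

lemma exists_closedBall_of_isCompact_support {μ : Measure (E d)} (h : IsCompact μ.support) :
    ∃ R : ℝ, μ (Metric.closedBall 0 R)ᶜ = 0 := by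
  obtain ⟨R, hR⟩ := h.isBounded.subset_closedBall 0
  exact ⟨R, measure_mono_null (compl_subset_compl.2 hR) Measure.measure_compl_support⟩

lemma lintegral_sq_lt_top_of_closedBall {μ : Measure (E d)} [IsProbabilityMeasure μ] {R : ℝ}
    (h : μ (Metric.closedBall 0 R)ᶜ = 0) : ∫⁻ x, ‖x‖ₑ ^ 2 ∂μ < ∞ := by
  have h' : ∀ᵐ x ∂μ, x ∈ Metric.closedBall (0 : E d) R := mem_ae_iff.2 h
  calc _ ≤ ∫⁻ _, ENNReal.ofReal R ^ 2 ∂μ := by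
        refine lintegral_mono_ae ?_
        filter_upwards [h'] with x hx
        gcongr
        rw [← ofReal_norm]
        exact ENNReal.ofReal_le_ofReal (mem_closedBall_zero_iff.1 hx)
    _ < ∞ := by simp

/-! ### An intrinsic description of flows of unit Lipschitz fields -/

/-- The flows `Φ t`, `t ∈ ℝ`, which start at the identity, are `1`-Lipschitz in time, and satisfy
the Grönwall estimate for the difference of two trajectories. -/
def unitFlows (d : ℕ) : Set (ℝ → E d → E d) :=
  {Φ | (∀ x, Φ 0 x = x) ∧ (∀ s t x, ‖Φ t x - Φ s x‖ ≤ |t - s|) ∧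
    ∀ s t x y, ‖(Φ t x - Φ t y) - (Φ s x - Φ s y)‖ ≤
      (Real.exp |t - s| - 1) * ‖Φ s x - Φ s y‖}

section
variable {Φ : ℝ → E d → E d} (hΦ : Φ ∈ unitFlows d)
include hΦ

lemma unitFlows_norm_sub_self_le (t : ℝ) (x : E d) : ‖Φ t x - x‖ ≤ |t| := by
  have := hΦ.2.1 0 t x
  rwa [hΦ.1, sub_zero] at this

lemma unitFlows_norm_sub_le (s t : ℝ) (x y : E d) :
    ‖Φ t x - Φ t y‖ ≤ Real.exp |t - s| * ‖Φ s x - Φ s y‖ := by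
  have h1 := hΦ.2.2 s t x y
  have h2 := norm_le_norm_add_norm_sub (Φ s x - Φ s y) (Φ t x - Φ t y)
  rw [norm_sub_rev (Φ s x - Φ s y)] at h2
  linarith

lemma unitFlows_lipschitz (t : ℝ) (x y : E d) :
    ‖Φ t x - Φ t y‖ ≤ Real.exp |t| * ‖x - y‖ := by
  have := unitFlows_norm_sub_le hΦ 0 t x y
  rwa [hΦ.1, hΦ.1, sub_zero] at this

lemma unitFlows_antilipschitz (t : ℝ) (x y : E d) :
    ‖x - y‖ ≤ Real.exp |t| * ‖Φ t x - Φ t y‖ := by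
  have := unitFlows_norm_sub_le hΦ t 0 x y
  rwa [hΦ.1, hΦ.1, zero_sub, abs_neg] at this

lemma unitFlows_lipschitzWith (t : ℝ) : LipschitzWith (Real.exp |t|).toNNReal (Φ t) :=
  LipschitzWith.of_dist_le_mul fun x y => by
    rw [dist_eq_norm, dist_eq_norm, Real.coe_toNNReal _ (Real.exp_pos _).le]
    exact unitFlows_lipschitz hΦ t x y

lemma unitFlows_antilipschitzWith (t : ℝ) : AntilipschitzWith (Real.exp |t|).toNNReal (Φ t) :=
  AntilipschitzWith.of_le_mul_dist fun x y => by
    rw [dist_eq_norm, dist_eq_norm, Real.coe_toNNReal _ (Real.exp_pos _).le]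
    exact unitFlows_antilipschitz hΦ t x y

lemma unitFlows_continuous (t : ℝ) : Continuous (Φ t) := (unitFlows_lipschitzWith hΦ t).continuous

lemma unitFlows_lipschitzWith_time (x : E d) : LipschitzWith 1 fun t => Φ t x :=
  LipschitzWith.of_dist_le_mul fun s t => by
    rw [dist_eq_norm, Real.dist_eq, NNReal.coe_one, one_mul]
    exact hΦ.2.1 t s x

/-- With a right inverse of `Φ s`, the map `Φ t ∘ (Φ s)⁻¹` differs from the identity by a map of
Lipschitz constant `exp |t - s| - 1 < 1`, and such a perturbation is onto. -/
lemma unitFlows_surjective_step {s t : ℝ} (hst : |t - s| ≤ 1 / 2)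
    (hs : Function.Surjective (Φ s)) : Function.Surjective (Φ t) := by
  have he : Real.exp |t - s| < 2 := by
    have h1 : Real.exp |t - s| ≤ Real.exp (1 / 2) := Real.exp_le_exp.2 hst
    have h2 : Real.exp (1 / 2) * Real.exp (1 / 2) = Real.exp 1 := by
      rw [← Real.exp_add]; norm_num
    have h3 := Real.exp_one_lt_d9
    nlinarith [Real.exp_pos (1 / 2)]
  set c : NNReal := (Real.exp |t - s| - 1).toNNReal with hc
  have hc0 : (c : ℝ) = Real.exp |t - s| - 1 :=
    Real.coe_toNNReal _ (by linarith [Real.add_one_le_exp |t - s|, abs_nonneg (t - s)])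
  have hg : ApproximatesLinearOn (fun a => Φ t (Function.surjInv hs a))
      ((ContinuousLinearEquiv.refl ℝ (E d) : E d ≃L[ℝ] E d) : E d →L[ℝ] E d) univ c := by
    intro a _ b _
    have := hΦ.2.2 s t (Function.surjInv hs a) (Function.surjInv hs b)
    rw [Function.surjInv_eq hs, Function.surjInv_eq hs] at this
    rw [hc0]
    simpa using this
  have hsurj := hg.surjective (by
    rcases subsingleton_or_nontrivial (E d) with h | h
    · exact Or.inl h
    · right
      have : ‖(((ContinuousLinearEquiv.refl ℝ (E d)).symm : E d ≃L[ℝ] E d) :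
          E d →L[ℝ] E d)‖₊ = 1 := by
        rw [ContinuousLinearEquiv.refl_symm, ContinuousLinearEquiv.coe_refl]
        exact nnnorm_one
      rw [this, inv_one, ← NNReal.coe_lt_coe, hc0, NNReal.coe_one]
      linarith)
  intro y
  obtain ⟨a, ha⟩ := hsurj y
  exact ⟨_, ha⟩

lemma unitFlows_surjective (t : ℝ) : Function.Surjective (Φ t) := by
  have key : ∀ n : ℕ, ∀ t : ℝ, |t| ≤ n / 2 → Function.Surjective (Φ t) := by
    intro n
    induction n with
    | zero =>
      intro t ht
      have : t = 0 := by simpa using ht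
      subst this
      exact fun y => ⟨y, hΦ.1 y⟩
    | succ n ih =>
      intro t ht
      have hn : (0 : ℝ) < n + 1 := by positivity
      push_cast at ht
      -- Cutting `[0, t]` into `n + 1` equal pieces makes each of length at most `1 / 2`.
      refine unitFlows_surjective_step hΦ (s := t * (n / (n + 1))) ?_ (ih _ ?_)
      · have : t - t * (n / (n + 1)) = t / (n + 1) := by field_simp; ring
        rw [this, abs_div, abs_of_pos hn, div_le_iff₀ hn]
        linarith
      · rw [abs_mul, abs_of_nonneg (by positivity : (0 : ℝ) ≤ n / (n + 1)), mul_div_assoc',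
          div_le_iff₀ hn]
        nlinarith [(Nat.cast_nonneg n : (0 : ℝ) ≤ n)]
  obtain ⟨n, hn⟩ := exists_nat_ge (2 * |t|)
  exact key n t (by linarith)

end

/-! ### Flows of unit Lipschitz fields belong to the class -/

/-- Grönwall is applied to the primitive of `‖δ‖` from `s`, whose derivative is at most `‖δ s‖` plus
the primitive itself. -/
lemma norm_sub_le_of_norm_sub_le_integral_of_le {δ : ℝ → E d} (hc : Continuous δ)
    (h : ∀ s t, ‖δ t - δ s‖ ≤ |∫ τ in s..t, ‖δ τ‖|) {s t : ℝ} (hst : s ≤ t) :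
    ‖δ t - δ s‖ ≤ (Real.exp (t - s) - 1) * ‖δ s‖ := by
  have hd : ∀ r, HasDerivAt (fun r => ∫ τ in s..r, ‖δ τ‖) ‖δ r‖ r := fun r =>
    intervalIntegral.integral_hasDerivAt_right (hc.norm.intervalIntegrable _ _)
      (hc.norm.stronglyMeasurableAtFilter _ _) hc.norm.continuousAt
  have hg := norm_le_gronwallBound_of_norm_deriv_right_le (a := s) (b := t) (δ := 0) (K := 1)
    (ε := ‖δ s‖) (f := fun r => ∫ τ in s..r, ‖δ τ‖) (f' := fun r => ‖δ r‖)
    (fun r _ => (hd r).continuousAt.continuousWithinAt)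
    (fun r _ => (hd r).hasDerivWithinAt) (by simp) (fun r _ => by
      have h1 := h s r
      have h2 := norm_le_norm_add_norm_sub (δ s) (δ r)
      rw [norm_sub_rev (δ s)] at h2
      rw [norm_norm, one_mul, Real.norm_eq_abs]
      linarith) t ⟨hst, le_rfl⟩
  refine (h s t).trans (hg.trans_eq ?_)
  simp [gronwallBound, mul_comm]

lemma norm_sub_le_of_norm_sub_le_integral {δ : ℝ → E d} (hc : Continuous δ)
    (h : ∀ s t, ‖δ t - δ s‖ ≤ |∫ τ in s..t, ‖δ τ‖|) (s t : ℝ) :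
    ‖δ t - δ s‖ ≤ (Real.exp |t - s| - 1) * ‖δ s‖ := by
  rcases le_total s t with hst | hst
  · rw [abs_of_nonneg (sub_nonneg.2 hst)]
    exact norm_sub_le_of_norm_sub_le_integral_of_le hc h hst
  -- Time reversal reduces to the ordered case.
  · have := norm_sub_le_of_norm_sub_le_integral_of_le (δ := fun r => δ (-r))
      (hc.comp continuous_neg) (fun a b => by
        rw [intervalIntegral.integral_comp_neg (fun r => ‖δ r‖), intervalIntegral.integral_symm,
          abs_neg]
        exact h _ _) (neg_le_neg hst)
    rw [abs_of_nonpos (sub_nonpos.2 hst)]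
    simpa [sub_eq_add_neg, add_comm] using this

lemma norm_le_one_of_lipNorm_le_one {f : E d → E d} (h : lipNorm f ≤ 1) (x : E d) :
    ‖f x‖ ≤ 1 := by
  have := (le_iSup (fun x => ‖f x‖ₑ) x).trans ((le_max_left _ _).trans h)
  rwa [← ofReal_norm, ENNReal.ofReal_le_one] at this

lemma norm_sub_le_of_lipNorm_le_one {f : E d → E d} (h : lipNorm f ≤ 1) (x y : E d) :
    ‖f x - f y‖ ≤ ‖x - y‖ := by
  rcases eq_or_ne x y with rfl | hne
  · simp
  have := (le_iSup₂ (f := fun x y => ‖f x - f y‖ₑ / ‖x - y‖ₑ) x y).trans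
    ((le_max_right _ _).trans h)
  rw [ENNReal.div_le_iff (by simpa [sub_eq_zero] using hne) (by simp), one_mul,
    ← ofReal_norm, ← ofReal_norm, ENNReal.ofReal_le_ofReal_iff (norm_nonneg _)] at this
  exact this

lemma lipNorm_le_one {f : E d → E d} (h1 : ∀ x, ‖f x‖ ≤ 1)
    (h2 : ∀ x y, ‖f x - f y‖ ≤ ‖x - y‖) : lipNorm f ≤ 1 := by
  refine max_le (iSup_le fun x => ?_) (iSup₂_le fun x y => ?_)
  · rw [← ofReal_norm, ENNReal.ofReal_le_one]
    exact h1 x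
  · refine ENNReal.div_le_of_le_mul ?_
    rw [one_mul, ← ofReal_norm, ← ofReal_norm]
    exact ENNReal.ofReal_le_ofReal (h2 x y)

lemma exists_mem_unitFlows_of_isFlow {ε : ℝ} (hε : 0 < ε) {v Φ : ℝ → E d → E d}
    (hv : IsUnitLipField ε v) (hΦ : IsFlow ε v Φ) :
    ∃ Ψ ∈ unitFlows d, ∀ t ∈ Icc 0 ε, Ψ t = Φ t := by
  have hlip : ∀ᵐ τ : ℝ, τ ∈ Icc 0 ε → lipNorm (v τ) ≤ 1 := by
    rw [← ae_restrict_iff' measurableSet_Icc]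
    filter_upwards [ENNReal.ae_le_essSup (μ := volume.restrict (Icc 0 ε))
      fun t => lipNorm (v t)] with t ht
    exact ht.trans hv.2
  -- Setting the velocity to zero outside `[0, ε]` freezes the trajectories there and extends the
  -- flow to all times.
  set u : E d → ℝ → E d := fun x => (Icc 0 ε).indicator fun τ => v τ (Φ τ x) with hu
  set Ψ : ℝ → E d → E d := fun t x => x + ∫ τ in (0 : ℝ)..t, u x τ with hΨ
  have hui : ∀ x, Integrable (u x) := fun x => by
    rw [hu, integrable_indicator_iff measurableSet_Icc, integrableOn_Icc_iff_integrableOn_Ioc]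
    exact (intervalIntegrable_iff_integrableOn_Ioc_of_le hε.le).1 (hΦ x).1
  have hEq : ∀ t ∈ Icc 0 ε, ∀ x, Ψ t x = Φ t x := fun t ht x => by
    rw [(hΦ x).2 t ht, hΨ]
    refine congrArg (x + ·) (intervalIntegral.integral_congr fun τ hτ => ?_)
    rw [uIcc_of_le ht.1] at hτ
    have hτ' : τ ∈ Icc 0 ε := ⟨hτ.1, hτ.2.trans ht.2⟩
    simp [hu, indicator_of_mem hτ']
  have hu1 : ∀ x, ∀ᵐ τ, ‖u x τ‖ ≤ 1 := fun x => by
    filter_upwards [hlip] with τ hτ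
    by_cases h : τ ∈ Icc 0 ε
    · rw [hu]
      simp only [indicator_of_mem h]
      exact norm_le_one_of_lipNorm_le_one (hτ h) _
    · simp [hu, indicator_of_notMem h]
  have hu2 : ∀ x y, ∀ᵐ τ, ‖u x τ - u y τ‖ ≤ ‖Ψ τ x - Ψ τ y‖ := fun x y => by
    filter_upwards [hlip] with τ hτ
    by_cases h : τ ∈ Icc 0 ε
    · rw [hEq τ h, hEq τ h, hu]
      simp only [indicator_of_mem h]
      exact norm_sub_le_of_lipNorm_le_one (hτ h) _ _
    · simp [hu, indicator_of_notMem h]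
  have hsub : ∀ s t x, Ψ t x - Ψ s x = ∫ τ in s..t, u x τ := fun s t x => by
    rw [hΨ]
    simp only [add_sub_add_left_eq_sub]
    exact intervalIntegral.integral_interval_sub_left (hui x).intervalIntegrable
      (hui x).intervalIntegrable
  have htime : ∀ s t x, ‖Ψ t x - Ψ s x‖ ≤ |t - s| := fun s t x => by
    rw [hsub, ← one_mul |t - s|]
    refine intervalIntegral.norm_integral_le_of_norm_le_const_ae ?_
    filter_upwards [hu1 x] with τ hτ _ using hτ
  have hcont : ∀ x, Continuous fun t => Ψ t x := fun x =>
    (LipschitzWith.of_dist_le_mul (K := 1) fun s t => by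
      rw [dist_eq_norm, Real.dist_eq, NNReal.coe_one, one_mul]
      exact htime t s x).continuous
  refine ⟨Ψ, ⟨fun x => by simp [hΨ], htime, fun s t x y => ?_⟩, fun t ht => funext (hEq t ht)⟩
  refine norm_sub_le_of_norm_sub_le_integral (δ := fun t => Ψ t x - Ψ t y)
    ((hcont x).sub (hcont y)) (fun s t => ?_) s t
  have : (Ψ t x - Ψ t y) - (Ψ s x - Ψ s y) = ∫ τ in s..t, (u x τ - u y τ) := by
    rw [intervalIntegral.integral_sub (hui x).intervalIntegrable (hui y).intervalIntegrable,
      ← hsub, ← hsub]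
    abel
  rw [this]
  refine intervalIntegral.norm_integral_le_abs_of_norm_le (ae_restrict_of_ae (hu2 x y)) ?_
  exact ((hcont x).sub (hcont y)).norm.intervalIntegrable _ _

/-! ### Elements of the class are flows of unit Lipschitz fields -/

section
open Filter Topology

lemma exp_sub_one_le_mul_one_add {u : ℝ} (h0 : 0 ≤ u) (h1 : u ≤ 1) : Real.exp u - 1 ≤ u * (1 + u) := by
  have := (abs_le.1 (Real.abs_exp_sub_one_sub_id_le (x := u) (by rwa [abs_of_nonneg h0]))).2
  nlinarith

variable {Φ : ℝ → E d → E d} (hΦ : Φ ∈ unitFlows d)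
include hΦ

lemma unitFlows_norm_slope_sub_slope_le {s t : ℝ} (hst : |s - t| ≤ 1) (x y : E d) :
    ‖slope (fun τ => Φ τ x) t s - slope (fun τ => Φ τ y) t s‖ ≤ 2 * ‖Φ t x - Φ t y‖ := by
  rcases eq_or_ne s t with rfl | hne
  · simp
  have hpos : 0 < |s - t| := abs_pos.2 (sub_ne_zero.2 hne)
  have h1 := hΦ.2.2 t s x y
  have h2 := exp_sub_one_le_mul_one_add (abs_nonneg (s - t)) hst
  have h3 : slope (fun τ => Φ τ x) t s - slope (fun τ => Φ τ y) t s =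
      (s - t)⁻¹ • ((Φ s x - Φ s y) - (Φ t x - Φ t y)) := by
    simp only [slope, vsub_eq_sub, ← smul_sub]
    congr 1
    abel
  rw [h3, norm_smul, norm_inv, Real.norm_eq_abs, inv_mul_le_iff₀ hpos]
  refine h1.trans ?_
  nlinarith [norm_nonneg (Φ t x - Φ t y),
    mul_le_mul_of_nonneg_right (h2.trans (mul_le_mul_of_nonneg_left (by linarith : 1 + |s - t| ≤ 2)
      hpos.le)) (norm_nonneg (Φ t x - Φ t y))]

/-- Near `t` the difference quotients are Lipschitz in `x` uniformly in the increment, so their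
Cauchy property passes from `Q` to its closure. This makes the exceptional null set of times
independent of `x`. -/
lemma unitFlows_differentiableAt_of_dense {Q : Set (E d)} (hQ : Dense Q) {t : ℝ}
    (h : ∀ x ∈ Q, DifferentiableAt ℝ (fun s => Φ s x) t) (x : E d) :
    DifferentiableAt ℝ (fun s => Φ s x) t := by
  suffices hc : Cauchy (map (slope (fun s => Φ s x) t) (𝓝[≠] t)) by
    obtain ⟨L, hL⟩ := cauchy_map_iff_exists_tendsto.1 hc
    exact (hasDerivAt_iff_tendsto_slope.2 hL).differentiableAt
  refine Metric.cauchy_iff.2 ⟨inferInstance, fun η hη => ?_⟩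
  set C := 2 * Real.exp |t| with hC
  have hCpos : 0 < C := by positivity
  obtain ⟨y, hyQ, hy⟩ := hQ.exists_dist_lt x (show 0 < η / 4 / C by positivity)
  have hlim := hasDerivAt_iff_tendsto_slope.1 (h y hyQ).hasDerivAt
  have h1 := Metric.tendsto_nhds.1 hlim (η / 4) (by positivity)
  have h2 : ∀ᶠ s in 𝓝[≠] t, |s - t| ≤ 1 :=
    nhdsWithin_le_nhds (Metric.closedBall_mem_nhds t one_pos)
  refine ⟨_, image_mem_map (h1.and h2), ?_⟩
  have hclose : ∀ s, |s - t| ≤ 1 →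
      dist (slope (fun τ => Φ τ x) t s) (slope (fun τ => Φ τ y) t s) < η / 4 := fun s hs => by
    rw [dist_eq_norm]
    refine (unitFlows_norm_slope_sub_slope_le hΦ hs x y).trans_lt ?_
    rw [dist_eq_norm, lt_div_iff₀ hCpos] at hy
    nlinarith [unitFlows_lipschitz hΦ t x y]
  rintro _ ⟨a, ⟨ha1, ha2⟩, rfl⟩ _ ⟨b, ⟨hb1, hb2⟩, rfl⟩
  have ha := hclose a ha2
  have hb := hclose b hb2
  rw [dist_comm] at hb hb1
  calc _ ≤ _ := dist_triangle4 _ (slope (fun τ => Φ τ y) t a) (slope (fun τ => Φ τ y) t b) _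
    _ < η := by
      have := dist_triangle (slope (fun τ => Φ τ y) t a) (deriv (fun τ => Φ τ y) t)
        (slope (fun τ => Φ τ y) t b)
      linarith

lemma unitFlows_ae_differentiableAt :
    ∀ᵐ t : ℝ, ∀ x, DifferentiableAt ℝ (fun s => Φ s x) t := by
  have : ∀ᵐ t : ℝ, ∀ n, DifferentiableAt ℝ (fun s => Φ s (TopologicalSpace.denseSeq (E d) n)) t :=
    ae_all_iff.2 fun n => (unitFlows_lipschitzWith_time hΦ _).ae_differentiableAt
  filter_upwards [this] with t ht
  refine unitFlows_differentiableAt_of_dense hΦ (TopologicalSpace.denseRange_denseSeq (E d)) ?_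
  rintro _ ⟨n, rfl⟩
  exact ht n

lemma unitFlows_norm_deriv_le (t : ℝ) (x : E d) : ‖deriv (fun s => Φ s x) t‖ ≤ 1 := by
  simpa using norm_deriv_le_of_lipschitz (unitFlows_lipschitzWith_time hΦ x) (x₀ := t)

lemma unitFlows_norm_deriv_sub_deriv_le {t : ℝ} (x y : E d)
    (hx : DifferentiableAt ℝ (fun s => Φ s x) t) (hy : DifferentiableAt ℝ (fun s => Φ s y) t) :
    ‖deriv (fun s => Φ s x) t - deriv (fun s => Φ s y) t‖ ≤ ‖Φ t x - Φ t y‖ := by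
  have hd := hx.hasDerivAt.sub hy.hasDerivAt
  -- The factor comes from `exp u - 1 ≤ u * (1 + u)`; the sharp constant `1` appears as `η → 0`.
  have key : ∀ η : ℝ, 0 < η → η ≤ 1 →
      ‖deriv (fun s => Φ s x) t - deriv (fun s => Φ s y) t‖ ≤ (1 + η) * ‖Φ t x - Φ t y‖ := by
    intro η hη hη1
    refine hd.le_of_lip' (by positivity) ?_
    filter_upwards [Metric.closedBall_mem_nhds t hη] with s hs
    have hs : |s - t| ≤ η := hs
    have h2 := exp_sub_one_le_mul_one_add (abs_nonneg (s - t)) (hs.trans hη1)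
    refine (hΦ.2.2 t s x y).trans ?_
    rw [Real.norm_eq_abs, mul_right_comm]
    refine mul_le_mul_of_nonneg_right (h2.trans ?_) (norm_nonneg _)
    rw [mul_comm]
    exact mul_le_mul_of_nonneg_right (by linarith) (abs_nonneg _)
  have hlim : Tendsto (fun η : ℝ => (1 + η) * ‖Φ t x - Φ t y‖) (𝓝[>] 0)
      (𝓝 ((1 + 0) * ‖Φ t x - Φ t y‖)) :=
    (Continuous.tendsto (by fun_prop) 0).mono_left nhdsWithin_le_nhds
  rw [add_zero, one_mul] at hlim
  refine ge_of_tendsto hlim ?_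
  filter_upwards [Ioc_mem_nhdsGT (zero_lt_one (α := ℝ))] with η hη
  exact key η hη.1 hη.2

lemma unitFlows_continuous_surjInv (y : E d) :
    Continuous fun t => Function.surjInv (unitFlows_surjective hΦ t) y := by
  refine continuous_iff_continuousAt.2 fun t => ?_
  have hb : ∀ s, dist (Function.surjInv (unitFlows_surjective hΦ s) y)
      (Function.surjInv (unitFlows_surjective hΦ t) y) ≤ Real.exp |t| * |t - s| := fun s => by
    rw [dist_eq_norm]
    refine (unitFlows_antilipschitz hΦ t _ _).trans ?_
    rw [Function.surjInv_eq (unitFlows_surjective hΦ t) y]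
    have := hΦ.2.1 s t (Function.surjInv (unitFlows_surjective hΦ s) y)
    rw [Function.surjInv_eq (unitFlows_surjective hΦ s) y] at this
    gcongr
  refine tendsto_iff_dist_tendsto_zero.2 (squeeze_zero (fun _ => dist_nonneg) hb ?_)
  have : Tendsto (fun s => Real.exp |t| * |t - s|) (𝓝 t) (𝓝 (Real.exp |t| * |t - t|)) :=
    Continuous.tendsto (by fun_prop) t
  simpa using this

/-- The field is `v t y = ∂ₜΦ t (Φ t)⁻¹ y`, with value `0` at the exceptional times. It is
measurable in `t` because `∂ₜΦ` is jointly measurable and the inverse is continuous in `t`. -/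
lemma exists_isUnitLipField_of_mem_unitFlows (ε : ℝ) :
    ∃ v, IsUnitLipField ε v ∧ IsFlow ε v Φ := by
  obtain ⟨N, hN, hNm, hN0⟩ := exists_measurable_superset_of_null
    (mem_ae_iff.1 (unitFlows_ae_differentiableAt hΦ))
  have hdiff : ∀ t ∉ N, ∀ x, DifferentiableAt ℝ (fun s => Φ s x) t := fun t ht =>
    not_not.1 fun h => ht (hN h)
  have hae : ∀ᵐ t, t ∉ N := measure_eq_zero_iff_ae_notMem.1 hN0
  -- Cutting off on a measurable null set makes both bounds hold at every time and keeps
  -- measurability.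
  set w : E d → ℝ → E d := fun x => Nᶜ.indicator (deriv fun s => Φ s x) with hw
  have hwm : ∀ x, Measurable (w x) := fun x => (measurable_deriv _).indicator hNm.compl
  have hw1 : ∀ t x, ‖w x t‖ ≤ 1 := fun t x => by
    by_cases ht : t ∈ N
    · simp [hw, ht]
    · simpa [hw, ht] using unitFlows_norm_deriv_le hΦ t x
  have hw2 : ∀ t x y, ‖w x t - w y t‖ ≤ ‖Φ t x - Φ t y‖ := fun t x y => by
    by_cases ht : t ∈ N
    · simp [hw, ht]
    · simpa [hw, ht] using
        unitFlows_norm_deriv_sub_deriv_le hΦ x y (hdiff t ht x) (hdiff t ht y)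
  have hwc : ∀ t, Continuous fun x => w x t := fun t =>
    (LipschitzWith.of_dist_le_mul (K := (Real.exp |t|).toNNReal) fun x y => by
      rw [dist_eq_norm, dist_eq_norm, Real.coe_toNNReal _ (Real.exp_pos _).le]
      exact (hw2 t x y).trans (unitFlows_lipschitz hΦ t x y)).continuous
  have hjoint := measurable_uncurry_of_continuous_of_measurable hwc hwm
  refine ⟨fun t y => w (Function.surjInv (unitFlows_surjective hΦ t) y) t, ⟨fun y => ?_, ?_⟩,
    fun x => ?_⟩
  · exact (hjoint.comp ((unitFlows_continuous_surjInv hΦ y).measurable.prodMk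
      measurable_id)).aestronglyMeasurable
  · refine essSup_le_of_ae_le _ (ae_of_all _ fun t => lipNorm_le_one (fun y => hw1 _ _) ?_)
    intro y z
    refine (hw2 t _ _).trans_eq ?_
    rw [Function.surjInv_eq (unitFlows_surjective hΦ t),
      Function.surjInv_eq (unitFlows_surjective hΦ t)]
  · have hinv : ∀ t, Function.surjInv (unitFlows_surjective hΦ t) (Φ t x) = x := fun t =>
      (unitFlows_antilipschitzWith hΦ t).injective (Function.surjInv_eq _ _)
    simp only [hinv]
    have hint : ∀ a b, IntervalIntegrable (w x) volume a b := fun a b =>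
      (intervalIntegrable_const (c := (1 : ℝ))).mono_fun (hwm x).aestronglyMeasurable
        (ae_of_all _ fun τ => by simpa using hw1 τ x)
    refine ⟨hint _ _, fun t ht => ?_⟩
    have hW : LipschitzWith 1 fun s => ∫ τ in (0 : ℝ)..s, w x τ :=
      LipschitzWith.of_dist_le_mul fun a b => by
        rw [dist_eq_norm, Real.dist_eq, NNReal.coe_one,
          intervalIntegral.integral_interval_sub_left (hint _ _) (hint _ _)]
        exact intervalIntegral.norm_integral_le_of_norm_le_const fun τ _ => hw1 τ x
    -- An absolutely continuous function with zero derivative almost everywhere is constant, which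
    -- yields the integral equation.
    have hac : AbsolutelyContinuousOnInterval
        (fun s => Φ s x - ∫ τ in (0 : ℝ)..s, w x τ) 0 t :=
      (((unitFlows_lipschitzWith_time hΦ x).sub hW).lipschitzOnWith).absolutelyContinuousOnInterval
    obtain ⟨C, hC⟩ := hac.const_of_ae_hasDerivAt_zero (by
      filter_upwards [hae, (hint 0 t).ae_hasDerivAt_integral] with s hs hs' hst
      have h1 := (hdiff s hs x).hasDerivAt
      have h2 := hs' hst 0 (by simp)
      have h3 : w x s = deriv (fun τ => Φ τ x) s := by simp [hw, hs]
      rw [h3] at h2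
      simpa using h1.fun_sub h2)
    have h0 := hC 0 (by simp)
    have ht := hC t (by simp)
    rw [intervalIntegral.integral_same, sub_zero, hΦ.1] at h0
    rw [← sub_eq_iff_eq_add, ht, h0]

end

/-! ### Pushforwards along the flows -/

section
variable {Φ : ℝ → E d → E d} (hΦ : Φ ∈ unitFlows d)
include hΦ

/-- Antilipschitz maps control the Hausdorff measure of preimages, and in top dimension it has the
same null sets as Lebesgue measure. -/
lemma unitFlows_volume_preimage_eq_zero (t : ℝ) {s : Set (E d)} (hs : volume s = 0) :
    volume (Φ t ⁻¹' s) = 0 := by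
  set H : Measure (E d) := Measure.hausdorffMeasure (Module.finrank ℝ (E d) : ℝ) with hH
  have hac : H ≪ volume := Measure.absolutelyContinuous_isAddHaarMeasure H volume
  have hca : volume ≪ H := Measure.absolutelyContinuous_isAddHaarMeasure volume H
  refine hca (le_antisymm ?_ zero_le)
  have := (unitFlows_antilipschitzWith hΦ t).hausdorffMeasure_preimage_le
    (Nat.cast_nonneg (Module.finrank ℝ (E d))) s
  rw [← hH, hac hs, mul_zero] at this
  exact this

lemma unitFlows_map_absolutelyContinuous {ρ : Measure (E d)} (hρ : ρ ≪ volume) (t : ℝ) :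
    ρ.map (Φ t) ≪ volume := by
  refine Measure.AbsolutelyContinuous.mk fun s hs h0 => ?_
  rw [Measure.map_apply (unitFlows_continuous hΦ t).measurable hs]
  exact hρ (unitFlows_volume_preimage_eq_zero hΦ t h0)

lemma unitFlows_map_compl_closedBall {ρ : Measure (E d)} {R : ℝ}
    (hρ : ρ (Metric.closedBall 0 R)ᶜ = 0) {t r : ℝ} (hr : R + |t| ≤ r) :
    ρ.map (Φ t) (Metric.closedBall 0 r)ᶜ = 0 := by
  rw [Measure.map_apply (unitFlows_continuous hΦ t).measurable
    Metric.isClosed_closedBall.measurableSet.compl]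
  refine measure_mono_null (fun x (hx : Φ t x ∉ _) (hx' : x ∈ _) => hx ?_) hρ
  rw [mem_closedBall_zero_iff] at hx' ⊢
  have h1 := norm_le_norm_add_norm_sub x (Φ t x)
  have h2 := unitFlows_norm_sub_self_le hΦ t x
  have h3 := norm_le_norm_add_norm_sub' (Φ t x) x
  linarith

end

/-- The pushforward of a compactly supported measure along a flow, as a point of `𝒫₂(ℝ^d)`. -/
noncomputable def pushforward (ρ : P2 d) (hρ : IsCompact ρ.toMeasure.support)
    (Φ : unitFlows d) (t : ℝ) : P2 d where
  toMeasure := ρ.toMeasure.map (Φ.1 t)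
  isProb := Measure.isProbabilityMeasure_map (unitFlows_continuous Φ.2 t).aemeasurable
  finiteSecondMoment := by
    obtain ⟨R, hR⟩ := exists_closedBall_of_isCompact_support hρ
    have := Measure.isProbabilityMeasure_map (μ := ρ.toMeasure)
      (unitFlows_continuous Φ.2 t).aemeasurable
    exact lintegral_sq_lt_top_of_closedBall (unitFlows_map_compl_closedBall Φ.2 hR le_rfl)

lemma W2_pushforward_le {ρ : P2 d} (hρ : IsCompact ρ.toMeasure.support) (Φ Ψ : unitFlows d)
    (s t : ℝ) {c : ℝ} (h : ∀ x ∈ ρ.toMeasure.support, ‖Φ.1 s x - Ψ.1 t x‖ ≤ c) :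
    W2 (pushforward ρ hρ Φ s) (pushforward ρ hρ Ψ t) ≤ ENNReal.ofReal c := by
  refine W2_le_of_mem_transportPlans (map_prodMk_mem_transportPlans ρ.toMeasure
    (unitFlows_continuous Φ.2 s).measurable (unitFlows_continuous Ψ.2 t).measurable) ?_
  refine lintegral_sq_map_prodMk_le _ (unitFlows_continuous Φ.2 s).measurable
    (unitFlows_continuous Ψ.2 t).measurable ?_
  filter_upwards [Measure.support_mem_ae (μ := ρ.toMeasure)] with x hx using h x hx

section
open Filter Topology

/-- `unitFlows d` carries the topology of pointwise convergence. The common Lipschitz constant at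
time `t` and a finite net of the support upgrade this to uniform convergence on the support. -/
lemma continuous_pushforward {ρ : P2 d} (hρ : IsCompact ρ.toMeasure.support) :
    Continuous fun p : unitFlows d × ℝ => pushforward ρ hρ p.1 p.2 := by
  refine continuous_iff_continuousAt.2 fun ⟨Φ, t⟩ => ?_
  rw [ContinuousAt, tendsto_nhds]
  intro U hU hmem
  obtain ⟨r, hr, hrU⟩ := isOpen_P2_iff.1 hU _ hmem
  set K := Real.exp |t| with hK
  have hKpos : 0 < K := Real.exp_pos _
  -- The four-term estimate below costs `K * η + η + K * η + η`, which this choice makes `r / 2`.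
  set η := r / (2 * (2 + 2 * K)) with hη
  have hηpos : 0 < η := by positivity
  obtain ⟨N, hN, hcover⟩ := Metric.totallyBounded_iff.1 hρ.totallyBounded η hηpos
  have h1 : ∀ᶠ p : unitFlows d × ℝ in 𝓝 (Φ, t), ∀ y ∈ N, dist (p.1.1 t y) (Φ.1 t y) < η := by
    rw [eventually_all_finite hN]
    intro y _
    have hc : Continuous fun p : unitFlows d × ℝ => p.1.1 t y :=
      (continuous_apply y).comp
        ((continuous_apply t).comp (continuous_subtype_val.comp continuous_fst))
    exact Metric.tendsto_nhds.1 (hc.tendsto (Φ, t)) η hηpos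
  have h2 : ∀ᶠ p : unitFlows d × ℝ in 𝓝 (Φ, t), dist p.2 t < η :=
    Metric.tendsto_nhds.1 (continuous_snd.tendsto (Φ, t)) η hηpos
  filter_upwards [h1, h2] with p hp1 hp2
  refine hrU _ ((W2_pushforward_le hρ Φ p.1 t p.2 (c := r / 2) fun x hx => ?_).trans_lt
    ((ENNReal.ofReal_lt_ofReal_iff hr).2 (by linarith)))
  obtain ⟨y, hyN, hy⟩ := mem_iUnion₂.1 (hcover hx)
  have e1 := unitFlows_lipschitz Φ.2 t x y
  have e2 := hp1 y hyN
  have e3 := unitFlows_lipschitz p.1.2 t y x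
  have e4 := p.1.2.2.1 p.2 t x
  rw [Metric.mem_ball, dist_eq_norm] at hy
  rw [dist_eq_norm, norm_sub_rev] at e2
  rw [Real.dist_eq, abs_sub_comm] at hp2
  rw [norm_sub_rev y x] at e3
  have hsum : Φ.1 t x - p.1.1 p.2 x = (Φ.1 t x - Φ.1 t y) + (Φ.1 t y - p.1.1 t y) +
      (p.1.1 t y - p.1.1 t x) + (p.1.1 t x - p.1.1 p.2 x) := by abel
  have htri := norm_add₄_le (a := Φ.1 t x - Φ.1 t y) (b := Φ.1 t y - p.1.1 t y)
    (c := p.1.1 t y - p.1.1 t x) (d := p.1.1 t x - p.1.1 p.2 x)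
  rw [← hsum] at htri
  have hηr : (2 + 2 * K) * η = r / 2 := by rw [hη]; field_simp
  have := mul_le_mul_of_nonneg_left hy.le hKpos.le
  linarith

/-- Tychonoff: the defining conditions are closed under pointwise convergence and confine `Φ t x` to
a closed ball. -/
lemma isCompact_unitFlows : IsCompact (unitFlows d) := by
  have hc : IsCompact {Φ : ℝ → E d → E d | ∀ t, Φ t ∈ {f : E d → E d |
      ∀ x, f x ∈ Metric.closedBall x |t|}} :=
    isCompact_pi_infinite fun t => isCompact_pi_infinite fun x => isCompact_closedBall x |t|
  refine hc.of_isClosed_subset ?_ fun Φ hΦ t x => ?_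
  · have he : ∀ t x, Continuous fun Φ : ℝ → E d → E d => Φ t x := fun t x =>
      (continuous_apply x).comp (continuous_apply t)
    simp only [unitFlows, ofPred_and, ofPred_forall]
    refine IsClosed.inter ?_ (IsClosed.inter ?_ ?_)
    · exact isClosed_iInter fun x => isClosed_eq (he 0 x) continuous_const
    · exact isClosed_iInter fun s => isClosed_iInter fun t => isClosed_iInter fun x =>
        isClosed_le ((he t x).sub (he s x)).norm continuous_const
    · exact isClosed_iInter fun s => isClosed_iInter fun t => isClosed_iInter fun x =>
        isClosed_iInter fun y => isClosed_le
          (((he t x).sub (he t y)).sub ((he s x).sub (he s y))).norm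
          (((he s x).sub (he s y)).norm.const_mul _)
  · rw [mem_closedBall_iff_norm]
    exact unitFlows_norm_sub_self_le hΦ t x

end

/-! ### The reachable set -/

lemma mem_Gamma_iff {ε : ℝ} (hε : 0 < ε) {ρ : P2 d} (hρ : IsCompact ρ.toMeasure.support)
    {μ : Measure (E d)} :
    μ ∈ Gamma ε ρ ↔ ∃ Φ : unitFlows d, ∃ t ∈ Icc 0 ε, μ = (pushforward ρ hρ Φ t).toMeasure := by
  constructor
  · rintro ⟨v, Φ, hv, hΦ, t, ht, rfl⟩
    obtain ⟨Ψ, hΨ, h⟩ := exists_mem_unitFlows_of_isFlow hε hv hΦ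
    exact ⟨⟨Ψ, hΨ⟩, t, ht, by rw [← h t ht]; rfl⟩
  · rintro ⟨Φ, t, ht, rfl⟩
    obtain ⟨v, hv, hΦ⟩ := exists_isUnitLipField_of_mem_unitFlows Φ.2 ε
    exact ⟨v, Φ.1, hv, hΦ, t, ht, rfl⟩

lemma pushforward_mem_PcAC {ρ : P2 d} (hρ : ρ ∈ PcAC d) (Φ : unitFlows d) (t : ℝ) :
    pushforward ρ hρ.1 Φ t ∈ PcAC d := by
  obtain ⟨R, hR⟩ := exists_closedBall_of_isCompact_support hρ.1
  exact ⟨isCompact_support_of_closedBall (unitFlows_map_compl_closedBall Φ.2 hR le_rfl),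
    unitFlows_map_absolutelyContinuous Φ.2 hρ.2 t⟩

lemma map_prodMk_id_mem_transportPlans {ρ : P2 d} (hρ : IsCompact ρ.toMeasure.support)
    (Φ : unitFlows d) (t : ℝ) :
    ρ.toMeasure.map (fun x => (Φ.1 t x, x)) ∈
      transportPlans (pushforward ρ hρ Φ t).toMeasure ρ.toMeasure := by
  have := map_prodMk_mem_transportPlans ρ.toMeasure (unitFlows_continuous Φ.2 t).measurable
    measurable_id
  rwa [Measure.map_id] at this

lemma lintegral_sq_map_prodMk_id_le (ρ : P2 d) (Φ : unitFlows d) {t c : ℝ} (h : |t| ≤ c) :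
    ∫⁻ p, ‖p.1 - p.2‖ₑ ^ 2 ∂(ρ.toMeasure.map fun x => (Φ.1 t x, x)) ≤ ENNReal.ofReal c ^ 2 :=
  lintegral_sq_map_prodMk_le ρ.toMeasure (unitFlows_continuous Φ.2 t).measurable measurable_id
    (ae_of_all _ fun x => (unitFlows_norm_sub_self_le Φ.2 t x).trans h)

lemma Gamma_subset {ε : ℝ} (hε : 0 < ε) {ρ : P2 d} (hρ : ρ ∈ PcAC d) :
    Gamma ε ρ ⊆ P2.toMeasure '' (PcAC d ∩ closedBallW2 ρ ε) := by
  intro μ hμ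
  obtain ⟨Φ, t, ht, rfl⟩ := (mem_Gamma_iff hε hρ.1).1 hμ
  refine ⟨_, ⟨pushforward_mem_PcAC hρ Φ t, ?_⟩, rfl⟩
  refine W2_le_of_mem_transportPlans (map_prodMk_id_mem_transportPlans hρ.1 Φ t)
    (lintegral_sq_map_prodMk_id_le ρ Φ ?_)
  rw [abs_of_nonneg ht.1]
  exact ht.2

lemma isCompact_Gamma {ε : ℝ} (hε : 0 < ε) {ρ : P2 d} (hρ : ρ ∈ PcAC d) :
    IsCompact {μ : P2 d | μ.toMeasure ∈ Gamma ε ρ} := by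
  have : CompactSpace (unitFlows d) := isCompact_iff_compactSpace.1 isCompact_unitFlows
  convert! (isCompact_univ.prod (isCompact_Icc (a := 0) (b := ε))).image
    (continuous_pushforward hρ.1)
  ext μ
  simp only [mem_ofPred_eq, mem_Gamma_iff hε hρ.1, mem_image, mem_prod, mem_univ, true_and,
    Prod.exists]
  exact exists_congr fun Φ => exists_congr fun t => and_congr_right fun _ =>
    ⟨fun h => P2.ext h.symm, fun h => h ▸ rfl⟩

lemma Gamma_compl_closedBall {ε : ℝ} (hε : 0 < ε) {ρ : P2 d} (hρ : ρ ∈ PcAC d) {R : ℝ}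
    (hR : ρ.toMeasure (Metric.closedBall 0 R)ᶜ = 0) {μ : Measure (E d)} (hμ : μ ∈ Gamma ε ρ) :
    μ (Metric.closedBall 0 (R + ε))ᶜ = 0 := by
  obtain ⟨Φ, t, ht, rfl⟩ := (mem_Gamma_iff hε hρ.1).1 hμ
  refine unitFlows_map_compl_closedBall Φ.2 hR ?_
  rw [abs_of_nonneg ht.1]
  linarith [ht.2]

/-! ### Nowhere density -/

lemma exists_uniform_far (hd : 1 ≤ d) {R : ℝ} (hR : 0 ≤ R) :
    ∃ l : Measure (E d), IsProbabilityMeasure l ∧ l ≪ volume ∧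
      l (Metric.closedBall 0 R)ᶜ = 1 ∧ l (Metric.closedBall 0 (R + 3))ᶜ = 0 := by
  have : Nonempty (Fin d) := ⟨⟨0, hd⟩⟩
  -- The unit ball around a point of norm `R + 2` lies between the radii `R` and `R + 3`.
  obtain ⟨z, hz⟩ := exists_norm_eq (E d) (show 0 ≤ R + 2 by positivity)
  set s := Metric.ball z 1 with hs
  have hs0 : volume s ≠ 0 := (Metric.measure_ball_pos volume z one_pos).ne'
  have hfin : volume s ≠ ∞ := measure_ball_lt_top.ne
  have hprob := ProbabilityTheory.cond_isProbabilityMeasure_of_finite hs0 hfin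
  have hs1 : ProbabilityTheory.cond volume s s = 1 :=
    ProbabilityTheory.cond_apply_self hs0 hfin
  have hsc : ProbabilityTheory.cond volume s sᶜ = 0 :=
    (prob_compl_eq_zero_iff Metric.isOpen_ball.measurableSet).2 hs1
  refine ⟨ProbabilityTheory.cond volume s, hprob, ProbabilityTheory.cond_absolutelyContinuous,
    le_antisymm prob_le_one ?_, ?_⟩
  · rw [← hs1]
    refine measure_mono fun x hx hx' => ?_
    rw [hs, Metric.mem_ball, dist_eq_norm, norm_sub_rev] at hx
    rw [mem_closedBall_zero_iff] at hx'
    linarith [norm_le_norm_add_norm_sub' z x]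
  · refine measure_mono_null (compl_subset_compl.2 fun x hx => ?_) hsc
    rw [hs, Metric.mem_ball, dist_eq_norm] at hx
    rw [mem_closedBall_zero_iff]
    linarith [norm_le_norm_add_norm_sub' x z]

lemma lintegral_sq_mix_le {π₁ π₂ : Measure (E d × E d)} {a : ℝ≥0∞} (ha : a ≤ 1) {δ A B c : ℝ}
    (hδ : 0 ≤ δ) (hA : 0 ≤ A) (hB : 0 ≤ B) (hc : 0 ≤ c) (h : A ^ 2 + δ * B ^ 2 ≤ c ^ 2)
    (h₁ : ∫⁻ p, ‖p.1 - p.2‖ₑ ^ 2 ∂π₁ ≤ ENNReal.ofReal A ^ 2)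
    (h₂ : ∫⁻ p, ‖p.1 - p.2‖ₑ ^ 2 ∂π₂ ≤ ENNReal.ofReal B ^ 2) :
    ∫⁻ p, ‖p.1 - p.2‖ₑ ^ 2 ∂(a • π₁ + ENNReal.ofReal δ • π₂) ≤ ENNReal.ofReal c ^ 2 := by
  rw [lintegral_add_measure, lintegral_smul_measure, lintegral_smul_measure, smul_eq_mul,
    smul_eq_mul]
  calc _ ≤ 1 * ENNReal.ofReal A ^ 2 + ENNReal.ofReal δ * ENNReal.ofReal B ^ 2 := by gcongr
    _ = ENNReal.ofReal (A ^ 2 + δ * B ^ 2) := by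
        rw [one_mul, ← ENNReal.ofReal_pow hA, ← ENNReal.ofReal_pow hB, ← ENNReal.ofReal_mul hδ,
          ← ENNReal.ofReal_add (by positivity) (by positivity)]
    _ ≤ ENNReal.ofReal c ^ 2 := by
        rw [← ENNReal.ofReal_pow hc]
        exact ENNReal.ofReal_le_ofReal h

/-- Every neighbourhood of a point of the reachable set contains a point of the closed ball that
charges the complement of the `ε`-neighbourhood of the support of the initial measure. -/
lemma exists_near_notMem_Gamma (hd : 1 ≤ d) {ε : ℝ} (hε : 0 < ε) {ρ : P2 d} (hρ : ρ ∈ PcAC d)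
    {μ : P2 d} (hμ : μ.toMeasure ∈ Gamma ε ρ) {r : ℝ} (hr : 0 < r) :
    ∃ ν ∈ PcAC d ∩ closedBallW2 ρ ε, W2 μ ν < ENNReal.ofReal r ∧ ν.toMeasure ∉ Gamma ε ρ := by
  obtain ⟨R₁, hR₁⟩ := exists_closedBall_of_isCompact_support hρ.1
  set R₀ := max R₁ 0 with hR₀def
  have hR₀0 : 0 ≤ R₀ := le_max_right _ _
  have hR₀ : ρ.toMeasure (Metric.closedBall 0 R₀)ᶜ = 0 := measure_mono_null
    (compl_subset_compl.2 (Metric.closedBall_subset_closedBall (le_max_left _ _))) hR₁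
  obtain ⟨Φ, t, ht, hμt⟩ := (mem_Gamma_iff hε hρ.1).1 hμ
  obtain rfl : μ = pushforward ρ hρ.1 Φ t := P2.ext hμt
  obtain ⟨l, hlp, hlac, hl1, hl0⟩ := exists_uniform_far hd (show 0 ≤ R₀ + ε by positivity)
  set R := R₀ + ε + 3 with hR
  have hRpos : 0 < R := by positivity
  set η := min ε r / 2 with hη
  have hηpos : 0 < η := by positivity
  have hηε : η ≤ ε / 2 := by rw [hη]; gcongr; exact min_le_left _ _
  have hηr : η ≤ r / 2 := by rw [hη]; gcongr; exact min_le_right _ _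
  -- Moving mass `δ` within a ball of diameter `2 * R` costs at most `η ^ 2`.
  set δ := (η / (2 * R)) ^ 2 with hδ
  have hδpos : 0 < δ := by positivity
  have hδη : δ * (2 * R) ^ 2 = η ^ 2 := by rw [hδ]; field_simp
  have hδ1 : δ ≤ 1 := by
    refine pow_le_one₀ (by positivity) ((div_le_one (by positivity)).2 ?_)
    linarith
  set a : ℝ≥0∞ := 1 - ENNReal.ofReal δ with ha
  have ha1 : a ≤ 1 := tsub_le_self
  have hab : a + ENNReal.ofReal δ = 1 := tsub_add_cancel_of_le (ENNReal.ofReal_le_one.2 hδ1)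
  -- Stopping by time `ε - η` leaves room for the far mass: `(ε - η) ^ 2 + η ^ 2 ≤ ε ^ 2`.
  set s := min t (ε - η) with hs
  have hs0 : 0 ≤ s := le_min ht.1 (by linarith)
  have hsε : s ≤ ε - η := min_le_right _ _
  have hst : |t - s| ≤ η := by
    rw [abs_of_nonneg (sub_nonneg.2 (min_le_left _ _)), sub_le_comm]
    exact le_min (by linarith) (by linarith [ht.2])
  have hball : ∀ τ, 0 ≤ τ → τ ≤ ε →
      (pushforward ρ hρ.1 Φ τ).toMeasure (Metric.closedBall 0 R)ᶜ = 0 := fun τ h0 h1 =>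
    unitFlows_map_compl_closedBall Φ.2 hR₀ (by rw [abs_of_nonneg h0]; linarith)
  have hρR : ρ.toMeasure (Metric.closedBall 0 R)ᶜ = 0 := measure_mono_null
    (compl_subset_compl.2 (Metric.closedBall_subset_closedBall (by linarith))) hR₀
  set m : Measure (E d) := a • (pushforward ρ hρ.1 Φ s).toMeasure + ENNReal.ofReal δ • l with hm
  have hmp : IsProbabilityMeasure m := isProbabilityMeasure_mix hab
  have hm0 : m (Metric.closedBall 0 R)ᶜ = 0 := by
    simp [hm, hball s hs0 (by linarith), hl0]
  have hmix : ∀ σ : Measure (E d), a • σ + ENNReal.ofReal δ • σ = σ := fun σ => by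
    rw [← add_smul, hab, one_smul]
  refine ⟨⟨m, hmp, lintegral_sq_lt_top_of_closedBall hm0⟩,
    ⟨⟨isCompact_support_of_closedBall hm0, ?_⟩, ?_⟩, ?_, fun hmem => ?_⟩
  · intro u hu
    have h1 := (pushforward_mem_PcAC hρ Φ s).2 hu
    have h2 := hlac hu
    simp [hm, h1, h2]
  · have hplan := mix_mem_transportPlans (map_prodMk_id_mem_transportPlans hρ.1 Φ s)
      (prod_mem_transportPlans l ρ.toMeasure) hab
    rw [hmix] at hplan
    refine W2_le_of_mem_transportPlans hplan (lintegral_sq_mix_le ha1 (A := ε - η) (B := 2 * R)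
      hδpos.le (by linarith) (by positivity) hε.le ?_
      (lintegral_sq_map_prodMk_id_le ρ Φ (by rwa [abs_of_nonneg hs0]))
      (lintegral_sq_transportPlan_le (prod_mem_transportPlans l ρ.toMeasure) hl0 hρR))
    rw [hδη]
    nlinarith
  · have hflow := map_prodMk_mem_transportPlans ρ.toMeasure
      (unitFlows_continuous Φ.2 t).measurable (unitFlows_continuous Φ.2 s).measurable
    have hprod := prod_mem_transportPlans (pushforward ρ hρ.1 Φ t).toMeasure l
    have hplan := mix_mem_transportPlans hflow hprod hab
    have heq : a • ρ.toMeasure.map (Φ.1 t) +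
        ENNReal.ofReal δ • (pushforward ρ hρ.1 Φ t).toMeasure =
        (pushforward ρ hρ.1 Φ t).toMeasure := hmix _
    rw [heq] at hplan
    -- Rewinding the flow and moving the far mass cost `η ^ 2` each; `2 * η ^ 2 ≤ (3 / 2 * η) ^ 2`,
    -- and `3 / 2 * η < r`.
    refine (W2_le_of_mem_transportPlans (c := ENNReal.ofReal (3 / 2 * η)) hplan
      (lintegral_sq_mix_le ha1 (A := η) (B := 2 * R) hδpos.le hηpos.le (by positivity)
      (by positivity) ?_ (lintegral_sq_map_prodMk_le ρ.toMeasure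
        (unitFlows_continuous Φ.2 t).measurable (unitFlows_continuous Φ.2 s).measurable
        (ae_of_all _ fun x => (Φ.2.2.1 s t x).trans hst))
      (lintegral_sq_transportPlan_le hprod (hball t ht.1 ht.2) hl0))).trans_lt
      ((ENNReal.ofReal_lt_ofReal_iff hr).2 (by linarith))
    rw [hδη]
    nlinarith
  -- Membership would force the mass outside radius `R₀ + ε` to vanish, but `l` puts `δ > 0` there.
  · have h0 := Gamma_compl_closedBall hε hρ hR₀ hmem
    simp only [hm, Measure.add_apply, Measure.smul_apply, hl1, smul_eq_mul, mul_one,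
      add_eq_zero, ENNReal.ofReal_eq_zero] at h0
    linarith [h0.2]

lemma isNowhereDense_Gamma {d : ℕ} (hd : 1 ≤ d) {ε : ℝ} (hε : 0 < ε) {ρ : P2 d}
    (hρ : ρ ∈ PcAC d) :
    IsNowhereDense {μ : ↥(PcAC d ∩ closedBallW2 ρ ε) | (μ : P2 d).toMeasure ∈ Gamma ε ρ} := by
  have hcl : IsClosed {μ : ↥(PcAC d ∩ closedBallW2 ρ ε) | (μ : P2 d).toMeasure ∈ Gamma ε ρ} :=
    (isCompact_Gamma hε hρ).isClosed.preimage continuous_subtype_val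
  rw [hcl.isNowhereDense_iff, eq_empty_iff_forall_notMem]
  intro μ hμ
  obtain ⟨V, hV, hVo, hμV⟩ := mem_interior.1 hμ
  obtain ⟨U, hU, rfl⟩ := isOpen_induced_iff.1 hVo
  obtain ⟨r, hr, hrU⟩ := isOpen_P2_iff.1 hU _ hμV
  obtain ⟨ν, hν, hdist, hnot⟩ := exists_near_notMem_Gamma hd hε hρ (hV hμV) hr
  exact hnot (hV (show (⟨ν, hν⟩ : ↥(PcAC d ∩ closedBallW2 ρ ε)) ∈ _ from hrU ν hdist))

end WassersteinFlow

theorem proposition2p8 (d : ℕ) (hd : 1 ≤ d) (ε : ℝ) (hε : 0 < ε)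
    (ρ₀ : WassersteinFlow.P2 d) (hρ₀ : ρ₀ ∈ WassersteinFlow.PcAC d) :
    WassersteinFlow.Gamma ε ρ₀ ⊆
        WassersteinFlow.P2.toMeasure ''
          (WassersteinFlow.PcAC d ∩ WassersteinFlow.closedBallW2 ρ₀ ε) ∧
      IsCompact {μ : WassersteinFlow.P2 d | μ.toMeasure ∈ WassersteinFlow.Gamma ε ρ₀} ∧
      IsNowhereDense
        {μ : ↥(WassersteinFlow.PcAC d ∩ WassersteinFlow.closedBallW2 ρ₀ ε) |
          (μ : WassersteinFlow.P2 d).toMeasure ∈ WassersteinFlow.Gamma ε ρ₀} :=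
  ⟨WassersteinFlow.Gamma_subset hε hρ₀, WassersteinFlow.isCompact_Gamma hε hρ₀,
    WassersteinFlow.isNowhereDense_Gamma hd hε hρ₀⟩
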